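/- **Setting.** A task set $\tau_1,\dots,\tau_n$ of sporadic DAG tasks is given; a lower index means a higher priority. Task $\tau_i$ has a finite directed acyclic graph $G_i$ with exactly one entry node (node $1$) and exactly one exit node ($\mathrm{last}$), for every node $v$ an interval $[c^v_{i,\min},c^v_{i,\max}]\subset[0,\infty)$ that contains its execution requirement, a relative deadline $D_i>0$, and a minimum inter-arrival time $T_i\ge D_i$. There are $m\ge1$ identical unit-speed cores, used by a preemptive global fixed-priority scheduler: at every instant a released, incomplete node all of whose predecessors are complete waits only while all $m$ cores execute nodes of tasks of the same or higher priority; a node occupies at most one core at a time; preemption and migration are free; ties between nodes of the same task are broken arbitrarily. The task set is *schedulable* if in every such schedule, for all release times that respect the $T_i$ and all actual execution requirements within the given intervals, every node of every job completes within $D_i$ of the release of the job. **Quantities.** $C_i=\sum_v c^v_{i,\max}$; $\mathrm{len}_i$ is the largest sum of the $c^v_{i,\max}$ along a directed path of $G_i$; $R_i^{\mathrm{isol}}=\mathrm{len}_i+\frac1m(C_i-\mathrm{len}_i)$. Earliest and latest release times of nodes are $$e_i^1=0,\quad e_i^v=\max_{u\to v}(e_i^u+c^u_{i,\min});\qquad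 \ell_i'^{\,\mathrm{last}}=0,\quad \ell_i'^{\,v}=\min_{v\to u}\ell_i'^{\,u}-c^v_{i,\max},\quad \ell_i^v=\ell_i'^{\,v}-\ell_i'^{\,1}.$$ Put $f^U_{i,v}(t)=\min(\max((t\bmod T_i)-e_i^v,0),c^v_{i,\max})$, $f^L_{i,v}(t)=\min(\max((t\bmod T_i)-\ell_i^v,0),c^v_{i,\max})$, $s_i=R_i-\mathrm{len}_i$, and for $X\in\{U,L\}$ $$F_i^X(t)=\begin{cases}\sum_v f^X_{i,v}(t)& t<T_i-s_i,\\ \left\lfloor\frac{t+s_i}{T_i}\right\rfloor C_i+\sum_v f^X_{i,v}((t+s_i)\bmod T_i)&\text{otherwise,}\end{cases}$$ $$W_i^{\mathrm{CI}}(\Delta)=\max_{\varphi\in[0,\mathrm{len}_i]}\{F_i^U(\Delta+\varphi)-F_i^L(\varphi)\},\qquad I_i(\Delta)=\frac1m\sum_{j<i}W_j^{\mathrm{CI}}(\Delta).$$ So every higher-priority task is assumed to have carry-in. The numbers $R_1,R_2,\dots$ are computed in this order by the iteration $R_i^{\{0\}}=R_i^{\mathrm{isol}}$, $R_i^{\{k\}}=I_i(R_i^{\{k-1\}})+R_i^{\mathrm{isol}}$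 for $k\ge1$, which stops at the first $k\ge1$ with $R_i^{\{k\}}=R_i^{\{k-1\}}$ or $R_i^{\{k\}}>D_i$; then $R_i=R_i^{\{k\}}$. **Theorem (sufficient schedulability condition).** If for every task the iteration stops with $R_i\le D_i$, then the task set is schedulable on $m$ cores under preemptive global fixed-priority scheduling. -/

import Mathlib

open MeasureTheory

noncomputable section

/-- A sporadic DAG task with constrained deadline: a finite acyclic digraph with exactly one entry
node and exactly one exit node, a range `[cmin v, cmax v]` for the execution requirement of every
node `v`, a relative deadline and a minimum inter-arrival time (period). -/
structure DAGTask where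
  numNodes : ℕ
  edge : Fin numNodes → Fin numNodes → Prop
  acyclic : ∀ v, ¬ Relation.TransGen edge v v
  entry : Fin numNodes
  exit : Fin numNodes
  entry_iff : ∀ v, (∀ u, ¬ edge u v) ↔ v = entry
  exit_iff : ∀ v, (∀ u, ¬ edge v u) ↔ v = exit
  cmin : Fin numNodes → ℝ
  cmax : Fin numNodes → ℝ
  cmin_nonneg : ∀ v, 0 ≤ cmin v
  cmin_le_cmax : ∀ v, cmin v ≤ cmax v
  deadline : ℝ
  period : ℝ
  deadline_pos : 0 < deadline
  deadline_le_period : deadline ≤ period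

namespace DAGTask

theorem wellFounded_edge (G : DAGTask) : WellFounded G.edge := by
  have : Std.Irrefl (Relation.TransGen G.edge) := ⟨G.acyclic⟩
  have h := Finite.wellFounded_of_trans_of_irrefl (Relation.TransGen G.edge)
  exact Subrelation.wf (fun {_ _} h => Relation.TransGen.single h) h

theorem wellFounded_flip_edge (G : DAGTask) : WellFounded (fun u v => G.edge v u) := by
  have : Std.Irrefl (fun u v => Relation.TransGen G.edge v u) := ⟨G.acyclic⟩
  have : IsTrans (Fin G.numNodes) (fun u v => Relation.TransGen G.edge v u) :=
    ⟨fun _ _ _ h₁ h₂ => h₂.trans h₁⟩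
  have h := Finite.wellFounded_of_trans_of_irrefl (fun u v => Relation.TransGen G.edge v u)
  exact Subrelation.wf (fun {_ _} h => Relation.TransGen.single h) h

/-- Total (worst-case) execution requirement `C`. -/
def totalWork (G : DAGTask) : ℝ := ∑ v, G.cmax v

/-- Critical path length: the maximal total execution requirement of a directed path. -/
def critLen (G : DAGTask) : ℝ :=
  sSup {x : ℝ | ∃ p : List (Fin G.numNodes), p.IsChain G.edge ∧ x = (p.map G.cmax).sum}

/-- Earliest release times, `e v = max {e u + cmin u | u parent of v}`; the entry node has no
parents and gets the value `0` (a supremum over the empty type in `ℝ`). -/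
def earliest (G : DAGTask) : Fin G.numNodes → ℝ :=
  G.wellFounded_edge.fix fun v e => ⨆ u : {u // G.edge u v}, (e u.1 u.2 + G.cmin u.1)

theorem earliest_eq (G : DAGTask) (v : Fin G.numNodes) :
    G.earliest v = ⨆ u : {u // G.edge u v}, (G.earliest u.1 + G.cmin u.1) :=
  G.wellFounded_edge.fix_eq _ v

open Classical in
/-- Latest release times, not normalized: `0` at the exit node and
`l' v = min {l' u | u child of v} - cmax v` at every other node. -/
def latestAux (G : DAGTask) : Fin G.numNodes → ℝ :=
  G.wellFounded_flip_edge.fix fun v l =>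
    if v = G.exit then 0 else (⨅ u : {u // G.edge v u}, l u.1 u.2) - G.cmax v

open Classical in
theorem latestAux_eq (G : DAGTask) (v : Fin G.numNodes) :
    G.latestAux v =
      if v = G.exit then 0 else (⨅ u : {u // G.edge v u}, G.latestAux u.1) - G.cmax v :=
  G.wellFounded_flip_edge.fix_eq _ v

/-- Latest release times, relative to the start of the entry node. -/
def latest (G : DAGTask) (v : Fin G.numNodes) : ℝ := G.latestAux v - G.latestAux G.entry

/-- Response time bound in isolation on `m` cores: `len + (C - len) / m`. -/
def isol (G : DAGTask) (m : ℕ) : ℝ := G.critLen + (1 / (m : ℝ)) * (G.totalWork - G.critLen)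

/-- The remainder `t mod T` for real numbers. -/
def realMod (t T : ℝ) : ℝ := t - ⌊t / T⌋ * T

/-- Upper bound function on the workload request of a single node. -/
def nodeUpper (G : DAGTask) (v : Fin G.numNodes) (t : ℝ) : ℝ :=
  min (max (realMod t G.period - G.earliest v) 0) (G.cmax v)

/-- Lower bound function on the workload request of a single node. -/
def nodeLower (G : DAGTask) (v : Fin G.numNodes) (t : ℝ) : ℝ :=
  min (max (realMod t G.period - G.latest v) 0) (G.cmax v)

open Classical in
/-- The function `F^U` of a task whose response time bound is `R`. -/
def taskUpper (G : DAGTask) (R t : ℝ) : ℝ :=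
  if t < G.period - (R - G.critLen) then ∑ v, G.nodeUpper v t
  else ⌊(t + (R - G.critLen)) / G.period⌋ * G.totalWork
    + ∑ v, G.nodeUpper v (realMod (t + (R - G.critLen)) G.period)

open Classical in
/-- The function `F^L` of a task whose response time bound is `R`. -/
def taskLower (G : DAGTask) (R t : ℝ) : ℝ :=
  if t < G.period - (R - G.critLen) then ∑ v, G.nodeLower v t
  else ⌊(t + (R - G.critLen)) / G.period⌋ * G.totalWork
    + ∑ v, G.nodeLower v (realMod (t + (R - G.critLen)) G.period)

/-- The carry-in workload bound `W^CI(Δ) = max {F^U(Δ + φ) - F^L(φ) | φ ∈ [0, len]}` of a task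
whose response time bound is `R`. -/
def carryInWorkload (G : DAGTask) (R Δ : ℝ) : ℝ :=
  sSup ((fun φ => G.taskUpper R (Δ + φ) - G.taskLower R φ) '' Set.Icc 0 G.critLen)

end DAGTask

/-! ### The response time algorithm

A task set is a family `τ : Fin n → DAGTask`; a lower index means a higher priority. -/

/-- `I_i(Δ) = (1/m) * ∑_{j < i} W_j^CI(Δ)`, where `R j` is the response time bound of task `j`. -/
def interference {n : ℕ} (m : ℕ) (τ : Fin n → DAGTask) (R : Fin n → ℝ) (i : Fin n) (Δ : ℝ) : ℝ :=
  (1 / (m : ℝ)) * ∑ j ∈ Finset.Iio i, (τ j).carryInWorkload (R j) Δ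

/-- The iterates `R_i^{k}`. -/
def responseIter {n : ℕ} (m : ℕ) (τ : Fin n → DAGTask) (R : Fin n → ℝ) (i : Fin n) : ℕ → ℝ
  | 0 => (τ i).isol m
  | k + 1 => interference m τ R i (responseIter m τ R i k) + (τ i).isol m

/-- The stopping criterion, tested after the computation of the iterate `k + 1`. -/
def responseStop {n : ℕ} (m : ℕ) (τ : Fin n → DAGTask) (R : Fin n → ℝ) (i : Fin n) (k : ℕ) : Prop :=
  responseIter m τ R i (k + 1) = responseIter m τ R i k ∨
    (τ i).deadline < responseIter m τ R i (k + 1)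

/-- For every task `i` the algorithm stops and `R i` is the iterate at which it first stops. The
iterates for task `i` use only the values `R j` with `j < i`, so there is at most one such `R`. -/
def IsComputedResponse {n : ℕ} (m : ℕ) (τ : Fin n → DAGTask) (R : Fin n → ℝ) : Prop :=
  ∀ i, ∃ k : ℕ, responseStop m τ R i k ∧ (∀ l < k, ¬ responseStop m τ R i l) ∧
    R i = responseIter m τ R i (k + 1)

/-! ### Global fixed-priority scheduling on `m` cores -/

/-- A sub-job: a node of the job of task `task` released at time `release`. (Distinct jobs of one
task have distinct release times.) -/
structure SubJob {n : ℕ} (τ : Fin n → DAGTask) where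
  task : Fin n
  release : ℝ
  node : Fin (τ task).numNodes

/-- A legal run-time behaviour of the sporadic tasks: for every task the set of its release times,
any two of which are at least one period apart, and the actual execution requirements. -/
structure Activation {n : ℕ} (τ : Fin n → DAGTask) where
  releases : Fin n → Set ℝ
  nonneg : ∀ i, ∀ r ∈ releases i, 0 ≤ r
  separated : ∀ i, ∀ r ∈ releases i, ∀ r' ∈ releases i, r < r' → r + (τ i).period ≤ r'
  req : SubJob τ → ℝ
  req_mem : ∀ x, req x ∈ Set.Icc ((τ x.task).cmin x.node) ((τ x.task).cmax x.node)

/-- What each of the `m` cores executes at each time (`none`: the core is idle). -/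
abbrev Schedule {n : ℕ} (m : ℕ) (τ : Fin n → DAGTask) := Fin m → ℝ → Option (SubJob τ)

namespace Schedule

variable {n m : ℕ} {τ : Fin n → DAGTask}

/-- The sub-job `x` is executed by some core at time `t`. -/
def Runs (σ : Schedule m τ) (x : SubJob τ) (t : ℝ) : Prop := ∃ p, σ p t = some x

/-- Amount of execution that `x` has received during `[0, t)`. -/
def executed (σ : Schedule m τ) (x : SubJob τ) (t : ℝ) : ℝ :=
  volume.real {s : ℝ | s ∈ Set.Ico 0 t ∧ σ.Runs x s}

/-- `x` has received its whole execution requirement by time `t`. -/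
def Completed (σ : Schedule m τ) (A : Activation τ) (x : SubJob τ) (t : ℝ) : Prop :=
  A.req x ≤ σ.executed x t

/-- `x` is pending at time `t`: its job has been released, `x` is not completed and all nodes of
the same job that precede `x` are completed. (Asking this of all ancestors rather than of the
parents makes a difference only if some node has execution requirement `0`.) -/
def Ready (σ : Schedule m τ) (A : Activation τ) (x : SubJob τ) (t : ℝ) : Prop :=
  x.release ∈ A.releases x.task ∧ x.release ≤ t ∧
    (∀ v, Relation.TransGen (τ x.task).edge v x.node →
      σ.Completed A ⟨x.task, x.release, v⟩ t) ∧
    ¬ σ.Completed A x t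

/-- `σ` is a fully preemptive global fixed-priority schedule of the activation `A`: a sub-job
occupies at most one core at a time, only ready sub-jobs are executed, and a ready sub-job waits
only while all cores execute sub-jobs of tasks of the same or higher priority. Preemption and
migration are free; ties between sub-jobs of the same task are broken arbitrarily. -/
structure IsGFP (σ : Schedule m τ) (A : Activation τ) : Prop where
  measurable : ∀ x, MeasurableSet {t : ℝ | σ.Runs x t}
  one_core : ∀ p q t x, σ p t = some x → σ q t = some x → p = q
  ready : ∀ p t x, σ p t = some x → σ.Ready A x t
  priority : ∀ x t, σ.Ready A x t → ¬ σ.Runs x t →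
    ∀ p, ∃ y : SubJob τ, σ p t = some y ∧ y.task ≤ x.task

end Schedule

/-- In every global fixed-priority schedule of every legal activation of the task set on `m` cores,
all nodes of all jobs are completed by the absolute deadline of their job. -/
def GFPSchedulable {n : ℕ} (m : ℕ) (τ : Fin n → DAGTask) : Prop :=
  ∀ (A : Activation τ) (σ : Schedule m τ), σ.IsGFP A →
    ∀ x : SubJob τ, x.release ∈ A.releases x.task →
      σ.Completed A x (x.release + (τ x.task).deadline)

end

noncomputable section

namespace DAGTask

variable (G : DAGTask)

/-! Write `s = R - len` and prove more than the deadline: every node `v` of every job completes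
within `s + latest v + cmax v` of its release (`MeetsBound`). This node-wise form is what limits the
work that a late job can still carry into a window. The induction runs over priorities and, within
one task, over release times.

Suppose that node `v` of a job released at `r` is incomplete at `r + d`, where `d = s + latest v +
cmax v`. At each instant of the window, either all `m` cores serve tasks of the same or higher
priority, or every ready node of the job runs, and at least one is ready. Instants of the second
kind have total length less than `latest v + cmax v` (`volume_idle_lt`). The descendants of `v` have
not started, so the job itself has received less than `C - len + latest v + cmax v`. Counting core
time (`mul_le_of_not_completed`) then contradicts the fixed-point equation for `R`, provided that
the workload bounds of the higher-priority tasks are valid.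

That proviso is the delicate point. `taskUpper` ignores the delay `s` on short windows, and
`carryInWorkload` is shown to bound the actual work only when its value is at least the work `C` of
one job (`sum_jobWork_le_carryInWorkload`). Exact termination of the iteration supplies this. A
fixed point reached in finitely many steps makes the interference equal at two different window
lengths, hence each monotone summand equal there. A summand is strictly increasing as long as it is
below `C` (`totalWork_le_carryInWorkload`), so each one has reached `C` (`response_fixed_point`). -/

theorem cmax_nonneg (v : Fin G.numNodes) : 0 ≤ G.cmax v :=
  (G.cmin_nonneg v).trans (G.cmin_le_cmax v)

theorem totalWork_nonneg : 0 ≤ G.totalWork := Finset.sum_nonneg fun v _ => G.cmax_nonneg v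

theorem period_pos : 0 < G.period := G.deadline_pos.trans_le G.deadline_le_period

/-! ### Earliest and latest release times -/

theorem earliest_entry_or (v : Fin G.numNodes) :
    G.earliest v = 0 ∨ ∃ u, G.edge u v ∧ G.earliest v = G.earliest u + G.cmin u := by
  rw [G.earliest_eq v]
  rcases isEmpty_or_nonempty {u // G.edge u v} with h | h
  · left; exact Real.iSup_of_isEmpty _
  · right
    obtain ⟨u, hu⟩ := exists_eq_ciSup_of_finite
      (f := fun u : {u // G.edge u v} => G.earliest u.1 + G.cmin u.1)
    exact ⟨u.1, u.2, hu.symm⟩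

theorem not_edge_exit (u : Fin G.numNodes) : ¬ G.edge G.exit u := (G.exit_iff G.exit).2 rfl u

theorem latest_add_cmax_le {u v : Fin G.numNodes} (h : G.edge u v) :
    G.latest u + G.cmax u ≤ G.latest v := by
  have hu : u ≠ G.exit := by rintro rfl; exact G.not_edge_exit v h
  have h1 := G.latestAux_eq u
  rw [if_neg hu] at h1
  have h2 : (⨅ w : {w // G.edge u w}, G.latestAux w.1) ≤ G.latestAux v :=
    ciInf_le (f := fun w : {w // G.edge u w} => G.latestAux w.1)
      (Set.finite_range _).bddBelow ⟨v, h⟩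
  unfold latest
  linarith

theorem exists_latest_eq {v : Fin G.numNodes} (hv : v ≠ G.exit) :
    ∃ u, G.edge v u ∧ G.latest u = G.latest v + G.cmax v := by
  have : Nonempty {u // G.edge v u} := by
    by_contra h
    exact hv ((G.exit_iff v).1 fun u hu => h ⟨⟨u, hu⟩⟩)
  obtain ⟨u, hu⟩ := exists_eq_ciInf_of_finite (f := fun u : {u // G.edge v u} => G.latestAux u.1)
  have h1 := G.latestAux_eq v
  rw [if_neg hv, ← hu] at h1
  refine ⟨u.1, u.2, ?_⟩
  unfold latest
  linarith

theorem latest_entry : G.latest G.entry = 0 := sub_self _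

theorem latest_nonneg (v : Fin G.numNodes) : 0 ≤ G.latest v := by
  induction v using G.wellFounded_edge.induction with
  | _ v ih =>
    by_cases hv : ∀ u, ¬ G.edge u v
    · rw [(G.entry_iff v).1 hv, latest_entry]
    · push Not at hv
      obtain ⟨u, hu⟩ := hv
      linarith [ih u hu, G.latest_add_cmax_le hu, G.cmax_nonneg u]

theorem latest_add_cmax_le_of_transGen {u v : Fin G.numNodes} (h : Relation.TransGen G.edge u v) :
    G.latest u + G.cmax u ≤ G.latest v := by
  induction h with
  | single h => exact G.latest_add_cmax_le h
  | @tail w _ _ h ih => linarith [G.latest_add_cmax_le h, G.cmax_nonneg w]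

theorem latest_add_cmax_le_exit (v : Fin G.numNodes) :
    G.latest v + G.cmax v ≤ G.latest G.exit + G.cmax G.exit := by
  induction v using G.wellFounded_flip_edge.induction with
  | _ v ih =>
    by_cases hv : v = G.exit
    · rw [hv]
    · obtain ⟨u, hu, h⟩ := G.exists_latest_eq hv
      linarith [ih u hu, G.cmax_nonneg u]

theorem latest_add_sum_le (v : Fin G.numNodes) (l : List (Fin G.numNodes))
    (h : (v :: l).IsChain G.edge) :
    G.latest v + ((v :: l).map G.cmax).sum ≤ G.latest G.exit + G.cmax G.exit := by
  induction l generalizing v with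
  | nil => simpa using G.latest_add_cmax_le_exit v
  | cons u l ih =>
    rw [List.isChain_cons_cons] at h
    have := ih u h.2
    have := G.latest_add_cmax_le h.1
    simp only [List.map_cons, List.sum_cons] at *
    linarith

theorem exists_chain_from (v : Fin G.numNodes) :
    ∃ l : List (Fin G.numNodes), (v :: l).IsChain G.edge ∧
      G.latest v + ((v :: l).map G.cmax).sum = G.latest G.exit + G.cmax G.exit := by
  induction v using G.wellFounded_flip_edge.induction with
  | _ v ih =>
    by_cases hv : v = G.exit
    · exact ⟨[], List.isChain_singleton _, by simp [hv]⟩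
    · obtain ⟨u, hu, h⟩ := G.exists_latest_eq hv
      obtain ⟨l, hl, hs⟩ := ih u hu
      refine ⟨u :: l, List.isChain_cons_cons.2 ⟨hu, hl⟩, ?_⟩
      simp only [List.map_cons, List.sum_cons] at *
      linarith

/-- Along an edge `latest` increases by at least `cmax`, which bounds every path; following the
edges with equality from the entry node gives a path that attains the bound. -/
theorem critLen_eq : G.critLen = G.latest G.exit + G.cmax G.exit := by
  have hub : ∀ x ∈ {x : ℝ | ∃ p : List (Fin G.numNodes), p.IsChain G.edge ∧
      x = (p.map G.cmax).sum}, x ≤ G.latest G.exit + G.cmax G.exit := by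
    rintro _ ⟨p, hp, rfl⟩
    cases p with
    | nil => simpa using add_nonneg (G.latest_nonneg _) (G.cmax_nonneg _)
    | cons v l => linarith [G.latest_add_sum_le v l hp, G.latest_nonneg v]
  apply le_antisymm
  · exact csSup_le ⟨0, [], List.isChain_nil, by simp⟩ hub
  · obtain ⟨l, hl, hs⟩ := G.exists_chain_from G.entry
    rw [latest_entry, zero_add] at hs
    exact le_csSup ⟨_, hub⟩ ⟨_, hl, hs.symm⟩

theorem latest_add_cmax_le_critLen (v : Fin G.numNodes) :
    G.latest v + G.cmax v ≤ G.critLen := by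
  rw [critLen_eq]; exact G.latest_add_cmax_le_exit v

theorem critLen_nonneg : 0 ≤ G.critLen := by
  rw [critLen_eq]; exact add_nonneg (G.latest_nonneg _) (G.cmax_nonneg _)

theorem cmax_eq_zero_of_totalWork (h : G.totalWork = 0) (v : Fin G.numNodes) : G.cmax v = 0 :=
  (Finset.sum_eq_zero_iff_of_nonneg fun v _ => G.cmax_nonneg v).1 h v (Finset.mem_univ v)

theorem critLen_pos (h : 0 < G.totalWork) : 0 < G.critLen := by
  obtain ⟨v, -, hv⟩ := Finset.exists_lt_of_sum_lt (f := fun _ => (0 : ℝ)) (g := G.cmax)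
    (s := Finset.univ) (by simpa [totalWork] using h)
  linarith [G.latest_add_cmax_le_critLen v, G.latest_nonneg v]

-- Follow the edges with equality in the recursion for `latest` from `v` to the exit: this path
-- consists of descendants of `v` and makes up the rest of `critLen`. It later charges the unstarted
-- descendants against the work of the job.
open Classical in
theorem critLen_le_add_sum_descendants (v : Fin G.numNodes) :
    G.critLen ≤ G.latest v + G.cmax v +
      ∑ w with Relation.TransGen G.edge v w, G.cmax w := by
  induction v using G.wellFounded_flip_edge.induction with
  | _ v ih =>
    by_cases hv : v = G.exit
    · rw [hv, critLen_eq]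
      linarith [Finset.sum_nonneg (s := Finset.univ.filter fun w =>
        Relation.TransGen G.edge G.exit w) fun w _ => G.cmax_nonneg w]
    · obtain ⟨u, hu, h⟩ := G.exists_latest_eq hv
      have h1 := ih u hu
      have h2 : ∑ w ∈ insert u (Finset.univ.filter fun w => Relation.TransGen G.edge u w),
          G.cmax w ≤ ∑ w with Relation.TransGen G.edge v w, G.cmax w := by
        refine Finset.sum_le_sum_of_subset_of_nonneg ?_ fun w _ _ => G.cmax_nonneg w
        intro w hw
        simp only [Finset.mem_insert, Finset.mem_filter, Finset.mem_univ, true_and] at hw ⊢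
        rcases hw with rfl | hw
        · exact .single hu
        · exact .head hu hw
      rw [Finset.sum_insert (by simp [G.acyclic u])] at h2
      linarith

theorem critLen_le_totalWork : G.critLen ≤ G.totalWork := by
  classical
  have h := G.critLen_le_add_sum_descendants G.entry
  have h2 : ∑ w ∈ insert G.entry (Finset.univ.filter fun w => Relation.TransGen G.edge G.entry w),
      G.cmax w ≤ G.totalWork :=
    Finset.sum_le_sum_of_subset_of_nonneg (Finset.subset_univ _) fun w _ _ => G.cmax_nonneg w
  rw [Finset.sum_insert (by simp [G.acyclic])] at h2
  rw [latest_entry] at h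
  linarith

theorem critLen_le_isol {m : ℕ} : G.critLen ≤ G.isol m := by
  unfold isol
  have : 0 ≤ 1 / (m : ℝ) * (G.totalWork - G.critLen) :=
    mul_nonneg (by positivity) (sub_nonneg.2 G.critLen_le_totalWork)
  linarith

end DAGTask

/-! ### Sums of clamped linear functions -/

/-- The amount of work done up to time `z` by independent jobs with starting times `a` and
lengths `c`. -/
def rampSum {ι : Type*} [Fintype ι] (a c : ι → ℝ) (z : ℝ) : ℝ :=
  ∑ v, min (max (z - a v) 0) (c v)

section rampSum

variable {ι : Type*} [Fintype ι] {a c : ι → ℝ}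

theorem rampSum_mono : Monotone (rampSum a c) := fun x y h =>
  Finset.sum_le_sum fun v _ => by gcongr

theorem rampSum_le (z : ℝ) : rampSum a c z ≤ ∑ v, c v :=
  Finset.sum_le_sum fun _ _ => min_le_right _ _

theorem rampSum_nonneg (hc : ∀ v, 0 ≤ c v) (z : ℝ) : 0 ≤ rampSum a c z :=
  Finset.sum_nonneg fun v _ => le_min (le_max_right _ _) (hc v)

theorem rampSum_eq_sum {z : ℝ} (h : ∀ v, a v + c v ≤ z) : rampSum a c z = ∑ v, c v :=
  Finset.sum_congr rfl fun v _ => min_eq_right (le_max_of_le_left (by linarith [h v]))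

theorem rampSum_eq_zero (hc : ∀ v, 0 ≤ c v) {z : ℝ} (h : ∀ v, z ≤ a v) : rampSum a c z = 0 :=
  Finset.sum_eq_zero fun v _ => by
    rw [max_eq_right (by linarith [h v]), min_eq_left (hc v)]

/-- `rampSum` grows with slope at least one where the intervals `[a v, a v + c v]` cover. -/
theorem le_rampSum_sub {p q : ℝ} (hpq : p ≤ q)
    (h : ∀ t ∈ Set.Icc p q, ∃ v, a v ≤ t ∧ t ≤ a v + c v) (hc : ∀ v, 0 ≤ c v) :
    q - p ≤ rampSum a c q - rampSum a c p := by
  have hsub : Set.Icc p q ⊆ ⋃ v, Set.Icc (max p (a v)) (min q (a v + c v)) := by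
    intro t ht
    obtain ⟨v, h1, h2⟩ := h t ht
    exact Set.mem_iUnion.2 ⟨v, max_le ht.1 h1, le_min ht.2 h2⟩
  have h1 : volume.real (Set.Icc p q) ≤
      ∑ v, volume.real (Set.Icc (max p (a v)) (min q (a v + c v))) := by
    refine (measureReal_mono hsub ?_).trans (measureReal_iUnion_fintype_le _)
    exact ((measure_iUnion_fintype_le _ _).trans_lt
      (ENNReal.sum_lt_top.2 fun v _ => measure_Icc_lt_top)).ne
  rw [Real.volume_real_Icc_of_le hpq] at h1
  refine h1.trans ?_
  rw [rampSum, rampSum, ← Finset.sum_sub_distrib]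
  refine Finset.sum_le_sum fun v _ => ?_
  rw [Real.volume_real_Icc]
  have := hc v
  rcases le_total p (a v) with h1 | h1 <;> rcases le_total q (a v + c v) with h2 | h2 <;>
  rcases le_total q (a v) with h3 | h3 <;> rcases le_total p (a v + c v) with h4 | h4 <;>
  simp only [max_def, min_def] <;> split_ifs <;> linarith

end rampSum

/-! ### Workload of one job and of periodic jobs as a function of time -/

namespace DAGTask

theorem realMod_nonneg {T : ℝ} (hT : 0 < T) (t : ℝ) : 0 ≤ realMod t T := by
  have := Int.floor_le (t / T)
  rw [le_div_iff₀ hT] at this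
  unfold realMod; linarith

theorem realMod_lt {T : ℝ} (hT : 0 < T) (t : ℝ) : realMod t T < T := by
  have := Int.lt_floor_add_one (t / T)
  rw [div_lt_iff₀ hT] at this
  unfold realMod; linarith

theorem realMod_of_mem {T t : ℝ} (h0 : 0 ≤ t) (h : t < T) : realMod t T = t := by
  have hT := h0.trans_lt h
  have : ⌊t / T⌋ = 0 := Int.floor_eq_zero_iff.2 ⟨div_nonneg h0 hT.le, (div_lt_one hT).2 h⟩
  simp [realMod, this]

theorem floor_mul_add_realMod (t T : ℝ) : ⌊t / T⌋ * T + realMod t T = t := by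
  unfold realMod; ring

theorem floor_int_mul_add {T z : ℝ} (k : ℤ) (h0 : 0 ≤ z) (h : z < T) :
    ⌊(k * T + z) / T⌋ = k ∧ realMod (k * T + z) T = z := by
  have hT := h0.trans_lt h
  have h1 : ⌊(k * T + z) / T⌋ = k := by
    rw [Int.floor_eq_iff, le_div_iff₀ hT, div_lt_iff₀ hT]
    constructor <;> linarith
  refine ⟨h1, ?_⟩
  rw [realMod, h1]; ring

variable (G : DAGTask)

/-- Maximal work of one job during the first `z` time units after its start. -/
def earlyWork (z : ℝ) : ℝ := rampSum G.earliest G.cmax z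

/-- Minimal work of one job of length `critLen` during the first `z` time units after its latest
start. -/
def lateWork (z : ℝ) : ℝ := rampSum G.latest G.cmax z

/-- Maximal work of the jobs released during an interval of length `y`. -/
def releasedWork (y : ℝ) : ℝ :=
  ⌊y / G.period⌋ * G.totalWork + G.earlyWork (realMod y G.period)

theorem earlyWork_mono : Monotone G.earlyWork := rampSum_mono

theorem earlyWork_le (z : ℝ) : G.earlyWork z ≤ G.totalWork := rampSum_le z

theorem earlyWork_nonneg (z : ℝ) : 0 ≤ G.earlyWork z := rampSum_nonneg G.cmax_nonneg z

theorem lateWork_le (z : ℝ) : G.lateWork z ≤ G.totalWork := rampSum_le z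

theorem lateWork_nonneg (z : ℝ) : 0 ≤ G.lateWork z := rampSum_nonneg G.cmax_nonneg z

theorem lateWork_of_nonpos {z : ℝ} (h : z ≤ 0) : G.lateWork z = 0 :=
  rampSum_eq_zero G.cmax_nonneg fun v => h.trans (G.latest_nonneg v)

theorem lateWork_critLen : G.lateWork G.critLen = G.totalWork :=
  rampSum_eq_sum G.latest_add_cmax_le_critLen

/-- Walk back through the parents that attain the maximum: because `cmin ≤ cmax`, consecutive
execution intervals leave no gap. Hence `earlyWork` has slope at least one until it saturates. -/
theorem exists_earliest_cover {t : ℝ} (h0 : 0 ≤ t) (v : Fin G.numNodes)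
    (hv : t ≤ G.earliest v + G.cmax v) :
    ∃ w, G.earliest w ≤ t ∧ t ≤ G.earliest w + G.cmax w := by
  induction v using G.wellFounded_edge.induction with
  | _ v ih =>
    by_cases hev : G.earliest v ≤ t
    · exact ⟨v, hev, hv⟩
    · rcases G.earliest_entry_or v with h | ⟨u, hu, h⟩
      · exact absurd (h.trans_le h0) hev
      · exact ih u hu (by linarith [G.cmin_le_cmax u])

/-- Walk forward through the children that attain the minimum; their intervals abut and end at
`critLen`. -/
theorem exists_latest_cover {t : ℝ} (ht : t ≤ G.critLen) (v : Fin G.numNodes)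
    (hv : G.latest v ≤ t) :
    ∃ w, G.latest w ≤ t ∧ t ≤ G.latest w + G.cmax w := by
  induction v using G.wellFounded_flip_edge.induction with
  | _ v ih =>
    by_cases hlv : t ≤ G.latest v + G.cmax v
    · exact ⟨v, hv, hlv⟩
    · by_cases hx : v = G.exit
      · rw [hx, ← critLen_eq] at hlv; exact absurd ht hlv
      · obtain ⟨u, hu, h⟩ := G.exists_latest_eq hx
        exact ih u hu (by linarith)

theorem min_le_earlyWork_add {t h : ℝ} (ht : 0 ≤ t) (hh : 0 ≤ h) :
    min (G.earlyWork t + h) G.totalWork ≤ G.earlyWork (t + h) := by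
  by_cases hsat : ∀ v, G.earliest v + G.cmax v ≤ t + h
  · exact (min_le_right _ _).trans (rampSum_eq_sum hsat).ge
  · push Not at hsat
    obtain ⟨v, hv⟩ := hsat
    refine (min_le_left _ _).trans ?_
    have := le_rampSum_sub (a := G.earliest) (c := G.cmax) (p := t) (q := t + h) (by linarith)
      (fun x hx => G.exists_earliest_cover (ht.trans hx.1) v (hx.2.trans hv.le)) G.cmax_nonneg
    unfold earlyWork; linarith

theorem lateWork_add_sub_le {p q : ℝ} (hp : 0 ≤ p) (hpq : p ≤ q) (hq : q ≤ G.critLen) :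
    G.lateWork p + (q - p) ≤ G.lateWork q := by
  have := le_rampSum_sub (a := G.latest) (c := G.cmax) hpq
    (fun x hx => G.exists_latest_cover (hx.2.trans hq) G.entry
      (by rw [latest_entry]; exact hp.trans hx.1)) G.cmax_nonneg
  unfold lateWork; linarith

theorem releasedWork_eq {z : ℝ} (k : ℤ) (h0 : 0 ≤ z) (h : z < G.period) :
    G.releasedWork (k * G.period + z) = k * G.totalWork + G.earlyWork z := by
  obtain ⟨h1, h2⟩ := floor_int_mul_add k h0 h
  rw [releasedWork, h1, h2]

theorem releasedWork_of_lt {z : ℝ} (h0 : 0 ≤ z) (h : z < G.period) :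
    G.releasedWork z = G.earlyWork z := by
  simpa using G.releasedWork_eq 0 h0 h

theorem exists_eq_mul_period_add (y : ℝ) :
    ∃ (k : ℤ) (z : ℝ), 0 ≤ z ∧ z < G.period ∧ y = k * G.period + z :=
  ⟨⌊y / G.period⌋, realMod y G.period, realMod_nonneg G.period_pos y, realMod_lt G.period_pos y,
    (floor_mul_add_realMod _ _).symm⟩

theorem releasedWork_add_period (y : ℝ) :
    G.releasedWork (y + G.period) = G.releasedWork y + G.totalWork := by
  obtain ⟨k, z, h0, h, rfl⟩ := G.exists_eq_mul_period_add y
  rw [G.releasedWork_eq k h0 h, show k * G.period + z + G.period = ((k + 1 : ℤ) : ℝ) * G.period + z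
    by push_cast; ring, G.releasedWork_eq _ h0 h]
  push_cast; ring

theorem releasedWork_mono : Monotone G.releasedWork := by
  intro x y hxy
  obtain ⟨k, z, h0, h, rfl⟩ := G.exists_eq_mul_period_add x
  obtain ⟨l, w, g0, g, rfl⟩ := G.exists_eq_mul_period_add y
  rw [G.releasedWork_eq k h0 h, G.releasedWork_eq l g0 g]
  have hkl : k ≤ l := by
    by_contra! hlk
    have : (l : ℝ) + 1 ≤ k := by exact_mod_cast hlk
    nlinarith [G.period_pos]
  rcases hkl.eq_or_lt with rfl | hkl
  · have := G.earlyWork_mono (show z ≤ w by linarith)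
    linarith
  · have : (k : ℝ) + 1 ≤ l := by exact_mod_cast hkl
    nlinarith [G.totalWork_nonneg, G.earlyWork_le z, G.earlyWork_nonneg w]

theorem totalWork_le_releasedWork {y : ℝ} (h : G.period ≤ y) : G.totalWork ≤ G.releasedWork y := by
  have h1 := G.releasedWork_mono h
  have h2 := G.releasedWork_add_period 0
  rw [G.releasedWork_of_lt le_rfl G.period_pos, zero_add] at h2
  linarith [G.earlyWork_nonneg 0]

theorem earlyWork_le_releasedWork {z : ℝ} (h : 0 ≤ z) : G.earlyWork z ≤ G.releasedWork z := by
  rcases lt_or_ge z G.period with h1 | h1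
  · rw [G.releasedWork_of_lt h h1]
  · exact (G.earlyWork_le z).trans (G.totalWork_le_releasedWork h1)

theorem releasedWork_nonneg {y : ℝ} (h : 0 ≤ y) : 0 ≤ G.releasedWork y :=
  (G.earlyWork_nonneg y).trans (G.earlyWork_le_releasedWork h)

/-- Within a period the slope is at least one until the current job is exhausted; a plateau can
therefore occur only at a whole number of jobs, at least `k + 1` of them. -/
theorem min_le_releasedWork_add {y h : ℝ} (k : ℕ) (hy : k * G.period ≤ y) (hh : 0 ≤ h) :
    min (G.releasedWork y + h) ((k + 1) * G.totalWork) ≤ G.releasedWork (y + h) := by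
  obtain ⟨l, z, h0, hz, rfl⟩ := G.exists_eq_mul_period_add y
  have hkl : (k : ℤ) ≤ l := by
    by_contra! hlk
    have : (l : ℝ) + 1 ≤ k := by exact_mod_cast hlk
    nlinarith [G.period_pos]
  have hkl' : (k : ℝ) ≤ l := by exact_mod_cast hkl
  rw [G.releasedWork_eq l h0 hz]
  rcases lt_or_ge (z + h) G.period with h1 | h1
  · rw [add_assoc (_ * G.period), G.releasedWork_eq l (by linarith) h1]
    rcases min_le_iff.1 (G.min_le_earlyWork_add h0 hh) with h2 | h2
    · exact (min_le_left _ _).trans (by linarith)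
    · refine (min_le_right _ _).trans ?_
      nlinarith [G.totalWork_nonneg]
  · refine (min_le_right _ _).trans ?_
    have h2 := G.releasedWork_mono (show ((l + 1 : ℤ) : ℝ) * G.period + 0 ≤ l * G.period + z + h by
      push_cast; linarith)
    rw [G.releasedWork_eq _ le_rfl G.period_pos] at h2
    push_cast at h2
    nlinarith [G.totalWork_nonneg, G.earlyWork_nonneg 0]

/-! ### The functions of the response time analysis -/

variable {G} {R : ℝ}

theorem taskUpper_of_lt {t : ℝ} (h0 : 0 ≤ t) (ht : t < G.period - (R - G.critLen))
    (hs : G.critLen ≤ R) : G.taskUpper R t = G.releasedWork t := by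
  rw [taskUpper, if_pos ht, G.releasedWork_of_lt h0 (by linarith)]
  simp only [nodeUpper, realMod_of_mem h0 (show t < G.period by linarith)]
  rfl

theorem taskUpper_of_ge {t : ℝ} (ht : G.period - (R - G.critLen) ≤ t) :
    G.taskUpper R t = G.releasedWork (t + (R - G.critLen)) := by
  rw [taskUpper, if_neg ht.not_gt, releasedWork]
  simp only [nodeUpper, realMod_of_mem (realMod_nonneg G.period_pos _) (realMod_lt G.period_pos _)]
  rfl

theorem releasedWork_le_taskUpper {t : ℝ} (h0 : 0 ≤ t) (hs : G.critLen ≤ R) :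
    G.releasedWork t ≤ G.taskUpper R t := by
  rcases lt_or_ge t (G.period - (R - G.critLen)) with h | h
  · rw [taskUpper_of_lt h0 h hs]
  · rw [taskUpper_of_ge h]
    exact G.releasedWork_mono (by linarith)

theorem taskUpper_mono {x y : ℝ} (h0 : 0 ≤ x) (hxy : x ≤ y) (hs : G.critLen ≤ R) :
    G.taskUpper R x ≤ G.taskUpper R y := by
  rcases lt_or_ge x (G.period - (R - G.critLen)) with h | h
  · rw [taskUpper_of_lt h0 h hs]
    exact (G.releasedWork_mono hxy).trans (releasedWork_le_taskUpper (h0.trans hxy) hs)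
  · rw [taskUpper_of_ge h, taskUpper_of_ge (h.trans hxy)]
    exact G.releasedWork_mono (by linarith)

theorem taskLower_eq {φ : ℝ} (h0 : 0 ≤ φ) (hφ : φ ≤ G.critLen) (hs : G.critLen ≤ R)
    (hR : R ≤ G.period) : G.taskLower R φ = G.lateWork φ := by
  rcases lt_or_ge φ (G.period - (R - G.critLen)) with h | h
  · rw [taskLower, if_pos h]
    simp only [nodeLower, realMod_of_mem h0 (show φ < G.period by linarith)]
    rfl
  · obtain rfl : φ = G.critLen := by linarith
    obtain rfl : R = G.period := by linarith
    have h1 := floor_int_mul_add (T := G.period) 1 le_rfl G.period_pos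
    have h2 : G.critLen + (G.period - G.critLen) = ((1 : ℤ) : ℝ) * G.period + 0 := by
      push_cast; ring
    rw [taskLower, if_neg h.not_gt, h2, h1.1, h1.2, lateWork_critLen]
    have : ∀ v, G.nodeLower v 0 = 0 := fun v => by
      rw [nodeLower, realMod_of_mem le_rfl G.period_pos, zero_sub,
        max_eq_right (neg_nonpos.2 (G.latest_nonneg v)), min_eq_left (G.cmax_nonneg v)]
    simp [this]

theorem le_carryInWorkload (hs : G.critLen ≤ R) (hR : R ≤ G.period)
    {Δ φ : ℝ} (hΔ : 0 ≤ Δ) (h0 : 0 ≤ φ) (hφ : φ ≤ G.critLen) :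
    G.taskUpper R (Δ + φ) - G.lateWork φ ≤ G.carryInWorkload R Δ := by
  rw [← taskLower_eq h0 hφ hs hR]
  refine le_csSup ⟨G.taskUpper R (Δ + G.critLen), ?_⟩ ⟨φ, ⟨h0, hφ⟩, rfl⟩
  rintro _ ⟨ψ, hψ, rfl⟩
  have h1 := taskUpper_mono (R := R) (G := G) (add_nonneg hΔ hψ.1)
    (add_le_add_right hψ.2 Δ) hs
  have h2 := taskLower_eq hψ.1 hψ.2 hs hR
  have h3 := G.lateWork_nonneg ψ
  simp only
  linarith

theorem carryInWorkload_le (hs : G.critLen ≤ R) (hR : R ≤ G.period)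
    {Δ b : ℝ}
    (h : ∀ φ, 0 ≤ φ → φ ≤ G.critLen → G.taskUpper R (Δ + φ) - G.lateWork φ ≤ b) :
    G.carryInWorkload R Δ ≤ b := by
  refine csSup_le (Set.Nonempty.image _ ⟨0, le_rfl, G.critLen_nonneg⟩) ?_
  rintro _ ⟨φ, hφ, rfl⟩
  have := h φ hφ.1 hφ.2
  rwa [← taskLower_eq hφ.1 hφ.2 hs hR] at this

theorem taskUpper_le_carryInWorkload (hs : G.critLen ≤ R) (hR : R ≤ G.period)
    {Δ : ℝ} (hΔ : 0 ≤ Δ) :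
    G.taskUpper R Δ ≤ G.carryInWorkload R Δ := by
  simpa [G.lateWork_of_nonpos le_rfl] using
    le_carryInWorkload hs hR hΔ le_rfl G.critLen_nonneg

theorem carryInWorkload_nonneg (hs : G.critLen ≤ R) (hR : R ≤ G.period)
    {Δ : ℝ} (hΔ : 0 ≤ Δ) : 0 ≤ G.carryInWorkload R Δ :=
  ((G.releasedWork_nonneg hΔ).trans (releasedWork_le_taskUpper hΔ hs)).trans
    (taskUpper_le_carryInWorkload hs hR hΔ)

theorem carryInWorkload_mono (hs : G.critLen ≤ R) (hR : R ≤ G.period)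
    {x y : ℝ} (hx : 0 ≤ x) (hxy : x ≤ y) :
    G.carryInWorkload R x ≤ G.carryInWorkload R y :=
  carryInWorkload_le hs hR fun φ h0 hφ =>
    (sub_le_sub_right (taskUpper_mono (add_nonneg hx h0) (by linarith) hs) _).trans
      (le_carryInWorkload hs hR (hx.trans hxy) h0 hφ)

/-- The carry-in workload bound is strictly increasing until it reaches the total work of one
job. -/
theorem totalWork_le_carryInWorkload (hs : G.critLen ≤ R) (hR : R ≤ G.period)
    {x y : ℝ} (hx : 0 ≤ x) (hxy : x < y)
    (h : G.carryInWorkload R x = G.carryInWorkload R y) :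
    G.totalWork ≤ G.carryInWorkload R y := by
  by_contra! hlt
  -- Half of the gap serves to let `taskUpper` grow, the other half to move `φ` to the left.
  set d := (y - x) / 2 with hd
  have hd0 : 0 < d := by rw [hd]; linarith
  have hy : y = x + 2 * d := by rw [hd]; ring
  have hy0 : 0 ≤ y := hx.trans hxy.le
  have key : G.carryInWorkload R x ≤ G.carryInWorkload R y - d := by
    refine carryInWorkload_le hs hR fun φ h0 hφ => ?_
    have hat := le_carryInWorkload hs hR hy0 h0 hφ
    have hmono := taskUpper_mono (R := R) (G := G) (x := x + φ + d) (y := y + φ)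
      (by positivity) (by linarith) hs
    rcases lt_or_ge (x + φ) (G.period - (R - G.critLen)) with ht | ht
    · have h1 := G.min_le_releasedWork_add (y := x + φ) (h := d) 0 (by simp; positivity) hd0.le
      have h2 := releasedWork_le_taskUpper (R := R) (G := G) (t := x + φ + d) (by positivity) hs
      have ht' := taskUpper_of_lt (G := G) (R := R) (t := x + φ) (by positivity) ht hs
      rcases min_le_iff.1 h1 with h1 | h1
      · linarith
      · have hC : G.taskUpper R (x + φ) ≤ G.totalWork := by
          rw [ht', G.releasedWork_of_lt (by positivity) (by linarith)]
          exact G.earlyWork_le _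
        have hsat : G.totalWork ≤ G.taskUpper R (x + φ + d) := by
          refine le_trans ?_ (h1.trans h2)
          simp
        -- The job is saturated at `x + φ + d`. Replacing `φ` by `φ - d` in the window `y` keeps
        -- this endpoint, while `lateWork` drops by at least `d`. If `φ < d`, the choice `φ = 0`
        -- already gives a full job.
        rcases le_total d φ with hφd | hφd
        · have h3 := le_carryInWorkload hs hR (φ := φ - d) hy0 (by linarith) (by linarith)
          rw [show y + (φ - d) = x + φ + d by rw [hy]; ring] at h3
          have h4 := G.lateWork_add_sub_le (p := φ - d) (q := φ) (by linarith) (by linarith) hφ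
          linarith
        · have h3 := taskUpper_le_carryInWorkload hs hR hy0
          have h4 := taskUpper_mono (R := R) (G := G) (x := x + φ + d) (y := y)
            (by positivity) (by linarith) hs
          linarith
    -- The shifted argument exceeds one period, so saturation means two full jobs; `lateWork`
    -- removes at most one.
    · have h1 := G.min_le_releasedWork_add (y := x + φ + (R - G.critLen)) (h := d) 1
        (by push_cast; linarith) hd0.le
      rw [taskUpper_of_ge ht]
      rw [taskUpper_of_ge (by linarith), show x + φ + d + (R - G.critLen) =
        x + φ + (R - G.critLen) + d by ring] at hmono
      rcases min_le_iff.1 h1 with h1 | h1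
      · linarith
      · push_cast at h1
        have := G.lateWork_le φ
        linarith
  linarith

end DAGTask

/-- A point of `N` close enough to its supremum cuts off arbitrarily little volume. -/
theorem exists_mem_lt_volume_inter_Iio {N : Set ℝ} {a b c : ℝ} (hN : N ⊆ Set.Ico a b) (hc : 0 ≤ c)
    (h : c < volume.real N) : ∃ s ∈ N, c < volume.real (N ∩ Set.Iio s) := by
  have hne : N.Nonempty := by
    by_contra h0
    rw [Set.not_nonempty_iff_eq_empty.1 h0, measureReal_empty] at h
    exact h.not_ge hc
  have hbdd : BddAbove N := bddAbove_Ico.mono hN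
  set d := volume.real N - c with hd
  obtain ⟨s, hs, hlt⟩ := exists_lt_of_lt_csSup hne (show sSup N - d / 2 < sSup N by linarith)
  refine ⟨s, hs, ?_⟩
  have hfin : volume (N ∩ Set.Iio s ∪ Set.Icc s (sSup N)) ≠ ⊤ := by
    refine ((measure_union_le _ _).trans_lt (ENNReal.add_lt_top.2 ⟨?_, measure_Icc_lt_top⟩)).ne
    exact (measure_mono (Set.inter_subset_left.trans hN)).trans_lt measure_Ico_lt_top
  have h1 : volume.real N ≤ volume.real (N ∩ Set.Iio s ∪ Set.Icc s (sSup N)) := by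
    refine measureReal_mono (fun x hx => ?_) hfin
    rcases lt_or_ge x s with h | h
    · exact .inl ⟨hx, h⟩
    · exact .inr ⟨h, le_csSup hbdd hx⟩
  have h2 := measureReal_union_le (μ := volume) (N ∩ Set.Iio s) (Set.Icc s (sSup N))
  rw [Real.volume_real_Icc_of_le (le_csSup hbdd hs)] at h2
  linarith

/-! ### Execution received by nodes and jobs in a schedule -/

namespace Schedule

variable {n m : ℕ} {τ : Fin n → DAGTask}

/-- Amount of execution that `x` receives during `[a, b)`. -/
def work (σ : Schedule m τ) (x : SubJob τ) (a b : ℝ) : ℝ :=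
  volume.real {s : ℝ | s ∈ Set.Ico a b ∧ σ.Runs x s}

/-- Amount of execution that the job of task `j` released at `r` receives during `[a, b)`. -/
def jobWork (σ : Schedule m τ) (j : Fin n) (r a b : ℝ) : ℝ :=
  ∑ v, σ.work ⟨j, r, v⟩ a b

variable {σ : Schedule m τ} {A : Activation τ} {x : SubJob τ}

theorem volume_work_ne_top (a b : ℝ) : volume {s : ℝ | s ∈ Set.Ico a b ∧ σ.Runs x s} ≠ ⊤ :=
  ((measure_mono fun _ h => h.1).trans_lt measure_Ico_lt_top).ne

theorem work_nonneg (a b : ℝ) : 0 ≤ σ.work x a b := measureReal_nonneg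

theorem work_mono {a b a' b' : ℝ} (ha : a' ≤ a) (hb : b ≤ b') : σ.work x a b ≤ σ.work x a' b' :=
  measureReal_mono (fun _ h => ⟨⟨ha.trans h.1.1, h.1.2.trans_le hb⟩, h.2⟩) (volume_work_ne_top _ _)

theorem work_le_of_forall_mem {a b c d : ℝ} (hcd : c ≤ d)
    (h : ∀ s ∈ Set.Ico a b, σ.Runs x s → s ∈ Set.Icc c d) : σ.work x a b ≤ d - c := by
  rw [← Real.volume_real_Icc_of_le hcd]
  exact measureReal_mono (fun s hs => h s hs.1 hs.2) measure_Icc_lt_top.ne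

theorem work_eq_zero_of_forall_not {a b : ℝ} (h : ∀ s ∈ Set.Ico a b, ¬ σ.Runs x s) :
    σ.work x a b = 0 := by
  have : {s : ℝ | s ∈ Set.Ico a b ∧ σ.Runs x s} = ∅ :=
    Set.eq_empty_of_forall_notMem fun s hs => h s hs.1 hs.2
  rw [work, this, measureReal_empty]

theorem work_le_work_add_work (a b c : ℝ) :
    σ.work x a c ≤ σ.work x a b + σ.work x b c := by
  refine (measureReal_mono ?_ ?_).trans (measureReal_union_le _ _)
  · intro s hs
    rcases lt_or_ge s b with h | h
    · exact .inl ⟨⟨hs.1.1, h⟩, hs.2⟩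
    · exact .inr ⟨⟨h, hs.1.2⟩, hs.2⟩
  · exact ((measure_union_le _ _).trans_lt (ENNReal.add_lt_top.2
      ⟨(volume_work_ne_top _ _).lt_top, (volume_work_ne_top _ _).lt_top⟩)).ne

theorem executed_mono : Monotone (σ.executed x) := fun _ _ h => work_mono le_rfl h

theorem Completed.mono {s t : ℝ} (hst : s ≤ t) (h : σ.Completed A x s) : σ.Completed A x t :=
  le_trans h (executed_mono hst)

theorem Runs.ready {t : ℝ} (h : σ.Runs x t) (hσ : σ.IsGFP A) : σ.Ready A x t :=
  hσ.ready _ t x h.choose_spec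

theorem req_nonneg (A : Activation τ) (x : SubJob τ) : 0 ≤ A.req x :=
  ((τ x.task).cmin_nonneg x.node).trans (A.req_mem x).1

/-- A sub-job runs only while incomplete, and received execution grows with slope at most one, so it
cannot jump over the requirement. -/
theorem executed_le_req (hσ : σ.IsGFP A) (t : ℝ) : σ.executed x t ≤ A.req x := by
  by_contra! hlt
  have h0 : ∀ s ≤ 0, σ.executed x s = 0 := fun s hs =>
    work_eq_zero_of_forall_not fun u hu => absurd (hu.1.trans_lt hu.2) hs.not_gt
  set K := {s : ℝ | σ.executed x s ≤ A.req x}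
  have hKlt : ∀ s ∈ K, s < t := fun s hs => by
    by_contra! h
    exact (hlt.trans_le (executed_mono h)).not_ge hs
  have hne : K.Nonempty := ⟨0, (h0 0 le_rfl).trans_le (req_nonneg A x)⟩
  have hbdd : BddAbove K := ⟨t, fun s hs => (hKlt s hs).le⟩
  set d := σ.executed x t - A.req x with hd
  obtain ⟨s, hs, hsd⟩ := exists_lt_of_lt_csSup hne (show sSup K - d / 2 < sSup K by linarith)
  have hs' : s ≤ sSup K := le_csSup hbdd hs
  have h1 := work_le_work_add_work (σ := σ) (x := x) 0 s t
  have h2 : σ.work x s t ≤ sSup K - s := by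
    refine work_le_of_forall_mem hs' fun u hu hr => ⟨hu.1, ?_⟩
    exact le_csSup hbdd (not_le.1 (hr.ready hσ).2.2.2).le
  have h3 : σ.executed x s ≤ A.req x := hs
  have h4 : σ.work x 0 t = σ.executed x t := rfl
  have h5 : σ.work x 0 s = σ.executed x s := rfl
  linarith

theorem work_le_req (hσ : σ.IsGFP A) {a b : ℝ} (ha : 0 ≤ a) : σ.work x a b ≤ A.req x :=
  (work_mono ha le_rfl).trans (executed_le_req hσ b)

theorem work_le_cmax (hσ : σ.IsGFP A) {a b : ℝ} (ha : 0 ≤ a) :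
    σ.work x a b ≤ (τ x.task).cmax x.node :=
  (work_le_req hσ ha).trans (A.req_mem x).2

theorem work_eq_zero_of_completed (hσ : σ.IsGFP A) {a b : ℝ} (h : σ.Completed A x a) :
    σ.work x a b = 0 :=
  work_eq_zero_of_forall_not fun _ hs hr => (hr.ready hσ).2.2.2 (h.mono hs.1)

theorem work_le_of_completed (hσ : σ.IsGFP A) {a b d : ℝ} (h : σ.Completed A x d) :
    σ.work x a b ≤ max (d - a) 0 := by
  rcases le_total d a with hda | hda
  · rw [work_eq_zero_of_completed hσ (h.mono hda)]; exact le_max_right _ _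
  · refine le_max_of_le_left (work_le_of_forall_mem hda fun s hs hr => ⟨hs.1, ?_⟩)
    by_contra! hlt
    exact (hr.ready hσ).2.2.2 (h.mono hlt.le)

theorem release_add_earliest_le (hσ : σ.IsGFP A) {i : Fin n} {r : ℝ} (v : Fin (τ i).numNodes)
    {t : ℝ} (hrt : r ≤ t) (h : ∀ u, Relation.TransGen (τ i).edge u v →
      σ.Completed A ⟨i, r, u⟩ t) : r + (τ i).earliest v ≤ t := by
  induction v using (τ i).wellFounded_edge.induction generalizing t with
  | _ v ih =>
    rcases (τ i).earliest_entry_or v with h0 | ⟨u, hu, hev⟩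
    · linarith
    · have ihu := ih u hu hrt fun w hw => h w (hw.tail hu)
      rcases ((τ i).cmin_nonneg u).eq_or_lt with hc | hc
      · linarith
      · have h1 : (τ i).cmin u ≤ σ.work ⟨i, r, u⟩ 0 t :=
          (A.req_mem ⟨i, r, u⟩).1.trans (h u (.single hu))
        have h2 : σ.work ⟨i, r, u⟩ 0 t ≤ t - (r + (τ i).earliest u) :=
          work_le_of_forall_mem ihu fun s hs hr =>
            ⟨ih u hu (hr.ready hσ).2.1 (hr.ready hσ).2.2.1, hs.2.le⟩
        linarith

theorem jobWork_nonneg (j : Fin n) (r a b : ℝ) : 0 ≤ σ.jobWork j r a b :=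
  Finset.sum_nonneg fun _ _ => work_nonneg _ _

theorem jobWork_mono (j : Fin n) (r : ℝ) {a b a' b' : ℝ} (ha : a' ≤ a) (hb : b ≤ b') :
    σ.jobWork j r a b ≤ σ.jobWork j r a' b' :=
  Finset.sum_le_sum fun _ _ => work_mono ha hb

theorem jobWork_le_earlyWork (hσ : σ.IsGFP A) (j : Fin n) (r : ℝ) {a b : ℝ} (ha : 0 ≤ a) :
    σ.jobWork j r a b ≤ (τ j).earlyWork (b - r) := by
  refine Finset.sum_le_sum fun v _ => le_min ?_ (work_le_cmax hσ ha)
  have h : ∀ s ∈ Set.Ico a b, σ.Runs ⟨j, r, v⟩ s → r + (τ j).earliest v ≤ s := fun s _ hr =>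
    release_add_earliest_le hσ v (hr.ready hσ).2.1 (hr.ready hσ).2.2.1
  rcases le_total b (r + (τ j).earliest v) with hb | hb
  · rw [work_eq_zero_of_forall_not fun s hs hr => ((h s hs hr).trans_lt hs.2).not_ge hb]
    exact le_max_right _ _
  · refine le_max_of_le_left ((work_le_of_forall_mem hb fun s hs hr =>
      ⟨h s hs hr, hs.2.le⟩).trans (by linarith))

/-- Every node `v` of every job of task `j` is completed at the latest possible time that lets the
job complete within `R` time units. -/
def MeetsBound (σ : Schedule m τ) (A : Activation τ) (j : Fin n) (R : ℝ) : Prop :=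
  ∀ r ∈ A.releases j, ∀ v, σ.Completed A ⟨j, r, v⟩
    (r + (R - (τ j).critLen + (τ j).latest v + (τ j).cmax v))

variable {j : Fin n} {R : ℝ}

/-- After `a`, node `v` receives at most the time left until its completion bound, and at most `cmax
v`; this is `cmax v` minus its term in `lateWork`. -/
theorem jobWork_le_sub_lateWork (hσ : σ.IsGFP A) {r : ℝ} (h : ∀ v, σ.Completed A ⟨j, r, v⟩
    (r + (R - (τ j).critLen + (τ j).latest v + (τ j).cmax v))) {a b : ℝ} (ha : 0 ≤ a) :
    σ.jobWork j r a b ≤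
      (τ j).totalWork - (τ j).lateWork (a - r - (R - (τ j).critLen)) := by
  rw [DAGTask.totalWork, DAGTask.lateWork, rampSum, ← Finset.sum_sub_distrib]
  refine Finset.sum_le_sum fun v _ => ?_
  have h1 := work_le_of_completed (a := a) (b := b) hσ (h v)
  have h2 := work_le_cmax (x := ⟨j, r, v⟩) (b := b) hσ ha
  have h3 := (τ j).cmax_nonneg v
  simp only at h2
  rcases min_choice (max (a - r - (R - (τ j).critLen) - (τ j).latest v) 0) ((τ j).cmax v)
    with h4 | h4
  · rcases max_choice (a - r - (R - (τ j).critLen) - (τ j).latest v) 0 with h5 | h5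
    · have h6 := min_le_right (max (a - r - (R - (τ j).critLen) - (τ j).latest v) 0)
        ((τ j).cmax v)
      rw [h4, h5] at h6
      rw [h4, h5]
      rw [max_eq_left (by linarith)] at h1
      linarith
    · rw [h4, h5]; linarith
  · have h6 := min_le_left (max (a - r - (R - (τ j).critLen) - (τ j).latest v) 0) ((τ j).cmax v)
    rw [h4] at h6 ⊢
    rcases le_max_iff.1 h6 with h7 | h7
    · rw [max_eq_right (by linarith)] at h1
      linarith
    · rw [sub_self]; linarith

theorem jobWork_eq_zero (hσ : σ.IsGFP A) {r : ℝ} (h : ∀ v, σ.Completed A ⟨j, r, v⟩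
    (r + (R - (τ j).critLen + (τ j).latest v + (τ j).cmax v))) {a b : ℝ} (ha : r + R ≤ a) :
    σ.jobWork j r a b = 0 :=
  Finset.sum_eq_zero fun v _ => work_eq_zero_of_completed hσ ((h v).mono (by
    linarith [(τ j).latest_add_cmax_le_critLen v]))

end Schedule

/-! ### Work of a higher-priority task in a window -/

/-- Remove the first release: if others follow, it costs at most one full job, and they fit into a
window shorter by one period. -/
theorem DAGTask.sum_earlyWork_le (G : DAGTask) (Q : Finset ℝ) {a b : ℝ} (hab : a ≤ b)
    (hQ : ∀ r ∈ Q, a ≤ r ∧ r ≤ b) (hsep : ∀ r ∈ Q, ∀ r' ∈ Q, r < r' → r + G.period ≤ r') :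
    ∑ r ∈ Q, G.earlyWork (b - r) ≤ G.releasedWork (b - a) := by
  induction Q using Finset.strongInduction generalizing a with
  | H Q ih =>
    rcases Q.eq_empty_or_nonempty with rfl | hne
    · simpa using G.releasedWork_nonneg (sub_nonneg.2 hab)
    · have hmem := Q.min'_mem hne
      set r := Q.min' hne with hr
      obtain ⟨har, hrb⟩ := hQ r hmem
      rw [← Finset.add_sum_erase Q _ hmem]
      refine le_trans ?_ (G.releasedWork_mono (show b - r ≤ b - a by linarith))
      have hlater : ∀ r' ∈ Q.erase r, r + G.period ≤ r' := fun r' h' =>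
        hsep r hmem r' (Finset.mem_of_mem_erase h') (Q.min'_lt_of_mem_erase_min' hne h')
      rcases (Q.erase r).eq_empty_or_nonempty with he | ⟨r', h'⟩
      · rw [he, Finset.sum_empty, add_zero]
        exact G.earlyWork_le_releasedWork (sub_nonneg.2 hrb)
      · have hb : r + G.period ≤ b := (hlater r' h').trans (hQ r' (Finset.mem_of_mem_erase h')).2
        have h1 := ih _ (Finset.erase_ssubset hmem) hb
          (fun s hs => ⟨hlater s hs, (hQ s (Finset.mem_of_mem_erase hs)).2⟩)
          (fun s hs s' hs' => hsep s (Finset.mem_of_mem_erase hs) s' (Finset.mem_of_mem_erase hs'))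
        have h2 := G.releasedWork_add_period (b - (r + G.period))
        rw [show b - (r + G.period) + G.period = b - r by ring] at h2
        linarith [G.earlyWork_le (b - r)]

namespace Schedule

variable {n m : ℕ} {τ : Fin n → DAGTask} {σ : Schedule m τ} {A : Activation τ} {j : Fin n} {R : ℝ}

/-- The carry-in workload bound is valid for a window whose bound is at least the work of one
job. -/
theorem sum_jobWork_le_carryInWorkload (hσ : σ.IsGFP A) (hj : σ.MeetsBound A j R)
    (hs : (τ j).critLen ≤ R) (hR : R ≤ (τ j).period) {a Δ : ℝ} (ha : 0 ≤ a) (hΔ : 0 ≤ Δ)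
    (hW : (τ j).totalWork ≤ (τ j).carryInWorkload R Δ) (Q : Finset ℝ)
    (hQ : ∀ r ∈ Q, r ∈ A.releases j ∧ r < a + Δ) :
    ∑ r ∈ Q, σ.jobWork j r a (a + Δ) ≤ (τ j).carryInWorkload R Δ := by
  have hsep : ∀ r ∈ Q, ∀ r' ∈ Q, r < r' → r + (τ j).period ≤ r' := fun r hr r' hr' =>
    A.separated j r (hQ r hr).1 r' (hQ r' hr').1
  rw [← Finset.sum_filter_add_sum_filter_not Q (fun r => r < a)]
  have hnew : ∀ c, c ≤ a + Δ → (∀ r ∈ Q, ¬ r < a → c ≤ r) →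
      ∑ r ∈ Q with ¬ r < a, σ.jobWork j r a (a + Δ) ≤ (τ j).releasedWork (a + Δ - c) := by
    intro c hc h
    refine (Finset.sum_le_sum fun r _ => jobWork_le_earlyWork hσ j r ha).trans
      ((τ j).sum_earlyWork_le _ hc (fun r hr => ?_) fun r hr r' hr' => ?_)
    · rw [Finset.mem_filter] at hr
      exact ⟨h r hr.1 hr.2, (hQ r hr.1).2.le⟩
    · exact hsep r (Finset.mem_filter.1 hr).1 r' (Finset.mem_filter.1 hr').1
  have hnew0 := hnew a (by linarith) fun r _ hr => not_lt.1 hr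
  rw [add_sub_cancel_left] at hnew0
  have hU := DAGTask.taskUpper_le_carryInWorkload hs hR hΔ
  have hGU := DAGTask.releasedWork_le_taskUpper (G := τ j) (R := R) hΔ hs
  rcases (Q.filter fun r => r < a).eq_empty_or_nonempty with he | hne
  · rw [he, Finset.sum_empty]
    linarith
  · have hmem := Finset.max'_mem _ hne
    set r := Finset.max' _ hne with hr
    obtain ⟨hrQ, hra⟩ := Finset.mem_filter.1 hmem
    -- Only the last job released before the window can carry in: since `R ≤ period`, older ones are
    -- finished by its release.
    have hold : ∑ r ∈ Q with r < a, σ.jobWork j r a (a + Δ) = σ.jobWork j r a (a + Δ) := by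
      refine Finset.sum_eq_single_of_mem r hmem fun r' hr' hne' => ?_
      have hlt : r' < r := lt_of_le_of_ne (Finset.le_max' _ _ hr') hne'
      have := hsep r' (Finset.mem_filter.1 hr').1 r hrQ hlt
      exact jobWork_eq_zero hσ (hj r' (hQ r' (Finset.mem_filter.1 hr').1).1) (by linarith)
    rw [hold]
    rcases le_or_gt (r + R) a with hRa | hRa
    · rw [jobWork_eq_zero hσ (hj r (hQ r hrQ).1) hRa]
      linarith
    have hnext : ∀ r' ∈ Q, ¬ r' < a → r + (τ j).period ≤ r' := fun r' hr' hlt =>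
      hsep r hrQ r' hr' (hra.trans_le (not_lt.1 hlt))
    have hlate := jobWork_le_sub_lateWork (b := a + Δ) hσ (hj r (hQ r hrQ).1) ha
    have hlate0 := (τ j).lateWork_nonneg (a - r - (R - (τ j).critLen))
    -- If no further job fits, the carry-in is at most one full job, and only `hW` covers it.
    -- Otherwise the window is long enough for `taskUpper` to include the shift `R - critLen`.
    rcases lt_or_ge (a + Δ) (r + (τ j).period) with hT | hT
    · rw [Finset.sum_eq_zero (s := Q.filter fun r => ¬ r < a) fun r' hr' => ?_]
      · linarith
      · rw [Finset.mem_filter] at hr'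
        exact absurd ((hnext r' hr'.1 hr'.2).trans_lt (hQ r' hr'.1).2) hT.not_gt
    · have h1 := hnew _ hT hnext
      have h2 := (τ j).releasedWork_add_period (a + Δ - (r + (τ j).period))
      rw [show a + Δ - (r + (τ j).period) + (τ j).period = a + Δ - r by ring] at h2
      -- The maximum is tested at `φ = a - r - (R - critLen)`, or at `φ = 0` when this is negative.
      rcases le_total (R - (τ j).critLen) (a - r) with hφ | hφ
      · have h3 := DAGTask.le_carryInWorkload hs hR (φ := a - r - (R - (τ j).critLen)) hΔ
          (by linarith) (by linarith)
        rw [DAGTask.taskUpper_of_ge (by linarith),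
          show Δ + (a - r - (R - (τ j).critLen)) + (R - (τ j).critLen) = a + Δ - r by ring] at h3
        linarith
      · rw [DAGTask.taskUpper_of_ge (by linarith)] at hU
        have h3 := (τ j).releasedWork_mono (show a + Δ - r ≤ Δ + (R - (τ j).critLen) by linarith)
        linarith

end Schedule

/-! ### Core-time accounting for an incomplete node -/

/-- If fewer than `m` of the sets `B x` contain the points of `S`, but at least one does, and every
other point of `[a, b)` belongs to at least `m` of them, then their total volume is large. -/
theorem mul_busy_add_idle_le {ι : Type*} (X : Finset ι) (B : ι → Set ℝ) {a b : ℝ} (hab : a ≤ b)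
    (hB : ∀ x, MeasurableSet (B x)) (hsub : ∀ x, B x ⊆ Set.Ico a b) {m : ℝ} {S : Set ℝ}
    (hS : S = {s | s ∈ Set.Ico a b ∧ ∑ x ∈ X, (B x).indicator (fun _ => (1 : ℝ)) s < m})
    (hidle : ∀ s ∈ S, ∃ x ∈ X, s ∈ B x) :
    m * (b - a - volume.real S) + volume.real S ≤ ∑ x ∈ X, volume.real (B x) := by
  have hmeas : MeasurableSet S := by
    rw [hS]
    have h : MeasurableSet {s | ∑ x ∈ X, (B x).indicator (fun _ => (1 : ℝ)) s < m} :=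
      measurableSet_lt (Finset.measurable_fun_sum X fun x _ =>
        measurable_const.indicator (hB x)) measurable_const
    exact measurableSet_Ico.inter h
  have hSsub : S ⊆ Set.Ico a b := by rw [hS]; exact fun s hs => hs.1
  have hfin : ∀ E ⊆ Set.Ico a b, volume E ≠ ⊤ := fun E hE =>
    ((measure_mono hE).trans_lt measure_Ico_lt_top).ne
  have hint : ∀ E ⊆ Set.Ico a b, MeasurableSet E → ∀ c : ℝ,
      Integrable (E.indicator fun _ => c) volume := fun E hE hm c =>
    (integrable_indicator_iff hm).2 (integrableOn_const (hfin E hE))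
  have hle : ∫ s, ((Set.Ico a b \ S).indicator (fun _ => m) s + S.indicator (fun _ => 1) s) ≤
      ∫ s, ∑ x ∈ X, (B x).indicator (fun _ => (1 : ℝ)) s := by
    refine integral_mono ((hint _ Set.sdiff_subset (measurableSet_Ico.diff hmeas) m).add
      (hint _ hSsub hmeas 1)) (integrable_finsetSum _ fun x _ => hint _ (hsub x) (hB x) 1) ?_
    intro s
    beta_reduce
    have hnn : ∀ x ∈ X, (0 : ℝ) ≤ (B x).indicator (fun _ => (1 : ℝ)) s := fun x _ =>
      Set.indicator_nonneg (fun _ _ => zero_le_one) s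
    by_cases hs : s ∈ S
    · obtain ⟨x, hx, hsx⟩ := hidle s hs
      simpa [hs, hsx] using Finset.single_le_sum hnn hx
    · by_cases hI : s ∈ Set.Ico a b
      · have : ¬ ∑ x ∈ X, (B x).indicator (fun _ => (1 : ℝ)) s < m := fun h =>
          hs (by rw [hS]; exact ⟨hI, h⟩)
        rw [Set.indicator_of_mem (Set.mem_sdiff_of_mem hI hs), Set.indicator_of_notMem hs, add_zero]
        exact not_lt.1 this
      · rw [Set.indicator_of_notMem fun h => hI h.1, Set.indicator_of_notMem hs, add_zero]
        exact Finset.sum_nonneg hnn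
  rw [integral_add (hint _ Set.sdiff_subset (measurableSet_Ico.diff hmeas) m) (hint _ hSsub hmeas 1),
    integral_indicator_const _ (measurableSet_Ico.diff hmeas), integral_indicator_const _ hmeas,
    integral_finsetSum _ fun x _ => hint _ (hsub x) (hB x) 1,
    measureReal_sdiff hSsub hmeas (hfin _ subset_rfl), Real.volume_real_Ico_of_le hab] at hle
  simp only [integral_indicator_const _ (hB _), smul_eq_mul, mul_one] at hle
  linarith

theorem Activation.finite_releases {n : ℕ} {τ : Fin n → DAGTask} (A : Activation τ) (j : Fin n)
    (t : ℝ) : {r | r ∈ A.releases j ∧ r < t}.Finite := by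
  have hT := (τ j).period_pos
  refine Set.Finite.of_finite_image (f := fun r => ⌊r / (τ j).period⌋)
    ((Set.finite_Icc 0 ⌊t / (τ j).period⌋).subset ?_) ?_
  · rintro _ ⟨r, hr, rfl⟩
    exact ⟨Int.floor_nonneg.2 (div_nonneg (A.nonneg j r hr.1) hT.le),
      Int.floor_le_floor (div_le_div_of_nonneg_right hr.2.le hT.le)⟩
  · have key : ∀ r ∈ A.releases j, ∀ r' ∈ A.releases j, r < r' →
        ⌊r / (τ j).period⌋ < ⌊r' / (τ j).period⌋ := by
      intro r hr r' hr' hlt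
      have h1 := div_le_div_of_nonneg_right (A.separated j r hr r' hr' hlt) hT.le
      rw [add_div, div_self hT.ne'] at h1
      have h2 := Int.floor_le_floor h1
      rw [Int.floor_add_one] at h2
      linarith
    intro r hr r' hr' heq
    by_contra hne
    rcases lt_or_gt_of_ne hne with h | h
    · exact (key r hr.1 r' hr'.1 h).ne heq
    · exact (key r' hr'.1 r hr.1 h).ne heq.symm

namespace Schedule

variable {n m : ℕ} {τ : Fin n → DAGTask} {σ : Schedule m τ} {A : Activation τ}

/-- While `v` is incomplete, the time during which ready nodes of the job cannot wait is shorter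
than the longest path that ends at `v`. -/
theorem volume_idle_lt {i : Fin n} {r t : ℝ} (hr : r ∈ A.releases i) {S : Set ℝ}
    (hS : S ⊆ Set.Ico r t)
    (hrun : ∀ s ∈ S, ∀ w, σ.Ready A ⟨i, r, w⟩ s → σ.Runs ⟨i, r, w⟩ s)
    (v : Fin (τ i).numNodes) {u : ℝ} (hv : ¬ σ.Completed A ⟨i, r, v⟩ u) :
    volume.real (S ∩ Set.Iio u) < (τ i).latest v + (τ i).cmax v := by
  induction v using (τ i).wellFounded_edge.transGen.induction generalizing u with
  | _ v ih =>
    set N := {s | (s ∈ S ∧ s < u) ∧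
      ∃ w, Relation.TransGen (τ i).edge w v ∧ ¬ σ.Completed A ⟨i, r, w⟩ s} with hNdef
    have hNS : N ⊆ Set.Ico r t := fun s hs => hS hs.1.1
    -- `N` collects the idle times at which an ancestor of `v` still blocks it. If `N` were too
    -- large, some late point of `N` would have an incomplete ancestor `w` with more idle time
    -- before it than the induction hypothesis for `w` allows.
    have hN : volume.real N ≤ (τ i).latest v := by
      by_contra! hlt
      obtain ⟨s, ⟨hsS, w, hw, hws⟩, hlt'⟩ :=
        exists_mem_lt_volume_inter_Iio hNS ((τ i).latest_nonneg v) hlt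
      have h1 := ih w hw hws
      have h2 : volume.real (N ∩ Set.Iio s) ≤ volume.real (S ∩ Set.Iio s) :=
        measureReal_mono (fun x hx => ⟨hx.1.1.1, hx.2⟩)
          ((measure_mono (Set.inter_subset_left.trans hS)).trans_lt measure_Ico_lt_top).ne
      linarith [(τ i).latest_add_cmax_le_of_transGen hw]
    have hsub : S ∩ Set.Iio u ⊆ {s | s ∈ Set.Ico 0 u ∧ σ.Runs ⟨i, r, v⟩ s} ∪ N := by
      intro s hs
      by_cases hanc : ∃ w, Relation.TransGen (τ i).edge w v ∧ ¬ σ.Completed A ⟨i, r, w⟩ s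
      · exact .inr ⟨⟨hs.1, hs.2⟩, hanc⟩
      · push Not at hanc
        have hrs := (hS hs.1).1
        exact .inl ⟨⟨(A.nonneg i r hr).trans hrs, hs.2⟩, hrun s hs.1 v
          ⟨hr, hrs, hanc, fun hc => hv (hc.mono (le_of_lt hs.2))⟩⟩
    have h1 := (measureReal_mono (μ := volume) hsub ((measure_union_le _ _).trans_lt
      (ENNReal.add_lt_top.2 ⟨(volume_work_ne_top _ _).lt_top,
        (measure_mono hNS).trans_lt measure_Ico_lt_top⟩)).ne).trans (measureReal_union_le _ _)
    have h2 : volume.real {s | s ∈ Set.Ico 0 u ∧ σ.Runs ⟨i, r, v⟩ s} < A.req ⟨i, r, v⟩ :=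
      not_le.1 hv
    have h3 := (A.req_mem ⟨i, r, v⟩).2
    simp only at h3
    linarith

-- Descendants of `v` cannot have run, and `v` itself falls strictly short of its requirement; this
-- strictness produces the final contradiction.
open Classical in
theorem jobWork_lt_of_not_completed (hσ : σ.IsGFP A) {i : Fin n} {r t : ℝ} (hr : 0 ≤ r)
    {v : Fin (τ i).numNodes} (hv : ¬ σ.Completed A ⟨i, r, v⟩ t) :
    σ.jobWork i r r t <
      (τ i).totalWork - ∑ w with Relation.TransGen (τ i).edge v w, (τ i).cmax w := by
  rw [DAGTask.totalWork, ← Finset.sum_filter_add_sum_filter_not Finset.univ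
    (fun w => Relation.TransGen (τ i).edge v w), add_sub_cancel_left, jobWork,
    ← Finset.sum_filter_add_sum_filter_not Finset.univ
    (fun w => Relation.TransGen (τ i).edge v w), Finset.sum_eq_zero, zero_add]
  · refine Finset.sum_lt_sum (fun w _ => work_le_cmax hσ hr) ⟨v, by simp [(τ i).acyclic], ?_⟩
    have h1 : σ.work ⟨i, r, v⟩ r t ≤ σ.executed ⟨i, r, v⟩ t := work_mono hr le_rfl
    exact (h1.trans_lt (not_le.1 hv)).trans_le (A.req_mem ⟨i, r, v⟩).2
  · intro w hw
    refine work_eq_zero_of_forall_not fun s hs hrun => hv ?_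
    exact ((hrun.ready hσ).2.2.1 v (Finset.mem_filter.1 hw).2).mono hs.2.le

/-- The total work of the tasks with priority at least that of `i` in the window between the
release of a job of task `i` and a time at which its node `v` is incomplete. -/
theorem mul_le_of_not_completed (hm : 0 < m) (hσ : σ.IsGFP A) {i : Fin n} {r t : ℝ}
    (hr : r ∈ A.releases i) (hrt : r ≤ t) {v : Fin (τ i).numNodes}
    (hv : ¬ σ.Completed A ⟨i, r, v⟩ t) (Q : Fin n → Finset ℝ)
    (hQ : ∀ j r', r' ∈ Q j ↔ r' ∈ A.releases j ∧ r' < t) :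
    m * (t - r) ≤ ∑ j ∈ Finset.Iic i, ∑ r' ∈ Q j, σ.jobWork j r' r t +
      (m - 1) * ((τ i).latest v + (τ i).cmax v) := by
  have hr0 := A.nonneg i r hr
  let X : Finset (Σ j : Fin n, ℝ × Fin (τ j).numNodes) :=
    (Finset.Iic i).sigma fun j => Q j ×ˢ Finset.univ
  let B : (Σ j : Fin n, ℝ × Fin (τ j).numNodes) → Set ℝ := fun y =>
    {s | s ∈ Set.Ico r t ∧ σ.Runs ⟨y.1, y.2.1, y.2.2⟩ s}
  set S : Set ℝ := {s | s ∈ Set.Ico r t ∧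
    ∑ y ∈ X, (B y).indicator (fun _ => (1 : ℝ)) s < m} with hS
  have hrun : ∀ s ∈ S, ∀ w, σ.Ready A ⟨i, r, w⟩ s → σ.Runs ⟨i, r, w⟩ s := by
    intro s hs w hw
    by_contra hnot
    refine hs.2.not_ge ?_
    choose y hy hyi using hσ.priority ⟨i, r, w⟩ s hw hnot
    let f : Fin m → Σ j : Fin n, ℝ × Fin (τ j).numNodes := fun p =>
      ⟨(y p).task, (y p).release, (y p).node⟩
    have hf : Function.Injective f := by
      intro p q hpq
      have hyy : y p = y q :=
        congrArg (fun z : (Σ j : Fin n, ℝ × Fin (τ j).numNodes) =>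
          (⟨z.1, z.2.1, z.2.2⟩ : SubJob τ)) hpq
      exact hσ.one_core p q s (y p) (hy p) (hyy ▸ hy q)
    have hfX : Finset.univ.map ⟨f, hf⟩ ⊆ X := by
      intro z hz
      obtain ⟨p, -, rfl⟩ := Finset.mem_map.1 hz
      have hready := hσ.ready p s _ (hy p)
      refine Finset.mem_sigma.2 ⟨Finset.mem_Iic.2 (hyi p), Finset.mem_product.2
        ⟨(hQ _ _).2 ⟨hready.1, hready.2.1.trans_lt hs.1.2⟩, Finset.mem_univ _⟩⟩
    refine le_trans ?_ (Finset.sum_le_sum_of_subset_of_nonneg hfX fun z _ _ =>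
      Set.indicator_nonneg (fun _ _ => zero_le_one) s)
    rw [Finset.sum_map]
    have hone : ∀ p, (B (f p)).indicator (fun _ => (1 : ℝ)) s = 1 := fun p =>
      Set.indicator_of_mem (show s ∈ B (f p) from ⟨hs.1, p, hy p⟩) _
    simp [hone]
  have hidle : ∀ s ∈ S, ∃ y ∈ X, s ∈ B y := by
    intro s hs
    -- A minimal incomplete node is ready, so it runs whenever the cores are not all occupied by
    -- tasks of sufficient priority.
    obtain ⟨w, hw, hmin⟩ := (τ i).wellFounded_edge.transGen.has_min
      {w | ¬ σ.Completed A ⟨i, r, w⟩ s} ⟨v, fun hc => hv (hc.mono hs.1.2.le)⟩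
    have hready : σ.Ready A ⟨i, r, w⟩ s :=
      ⟨hr, hs.1.1, fun u hu => by_contra fun hc => hmin u hc hu, hw⟩
    exact ⟨⟨i, r, w⟩, Finset.mem_sigma.2 ⟨Finset.mem_Iic.2 le_rfl, Finset.mem_product.2
      ⟨(hQ _ _).2 ⟨hr, hs.1.1.trans_lt hs.1.2⟩, Finset.mem_univ _⟩⟩, hs.1, hrun s hs w hready⟩
  have h1 := mul_busy_add_idle_le X B hrt
    (fun y => measurableSet_Ico.inter (hσ.measurable _)) (fun y s hs => hs.1) hS hidle
  have h2 : ∑ y ∈ X, volume.real (B y) =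
      ∑ j ∈ Finset.Iic i, ∑ r' ∈ Q j, σ.jobWork j r' r t := by
    rw [Finset.sum_sigma]
    exact Finset.sum_congr rfl fun j _ => Finset.sum_product _ _ _
  have h3 := volume_idle_lt hr (fun s hs => hs.1) hrun v hv
  rw [Set.inter_eq_left.2 fun s hs => hs.1.2] at h3
  have hm1 : (1 : ℝ) ≤ m := by exact_mod_cast hm
  rw [← h2]
  have h4 := mul_le_mul_of_nonneg_left h3.le (sub_nonneg.2 hm1)
  linarith

end Schedule

/-! ### Induction over priorities and release times -/

namespace Schedule

variable {n m : ℕ} {τ : Fin n → DAGTask} {σ : Schedule m τ} {A : Activation τ}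

theorem meetsBound_of_totalWork_eq_zero {i : Fin n} (h : (τ i).totalWork = 0) (R : ℝ) :
    σ.MeetsBound A i R := fun r _ v => by
  have h1 := (A.req_mem ⟨i, r, v⟩).2
  simp only [(τ i).cmax_eq_zero_of_totalWork h v] at h1
  exact h1.trans (work_nonneg _ _)

theorem meetsBound_of_higher_priority (hm : 0 < m) (hσ : σ.IsGFP A) {R : Fin n → ℝ} {i : Fin n}
    (hs : ∀ j, (τ j).critLen ≤ R j) (hT : ∀ j, R j ≤ (τ j).period)
    (hfix : R i = interference m τ R i (R i) + (τ i).isol m)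
    (hW : ∀ j < i, (τ j).totalWork ≤ (τ j).carryInWorkload (R j) (R i))
    (hhp : ∀ j < i, σ.MeetsBound A j (R j)) : σ.MeetsBound A i (R i) := by
  classical
  have hT0 := (τ i).period_pos
  have hm0 : (0 : ℝ) < m := by exact_mod_cast hm
  have hRi : 0 ≤ R i := (τ i).critLen_nonneg.trans (hs i)
  -- Releases are separated by a period, so induction on the number of periods makes the bound
  -- available for all earlier jobs of the same task.
  suffices H : ∀ k : ℕ, ∀ r ∈ A.releases i, r < k * (τ i).period → ∀ v, σ.Completed A ⟨i, r, v⟩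
      (r + (R i - (τ i).critLen + (τ i).latest v + (τ i).cmax v)) by
    intro r hr
    obtain ⟨k, hk⟩ := exists_nat_gt (r / (τ i).period)
    exact H k r hr ((div_lt_iff₀ hT0).1 hk)
  intro k
  induction k with
  | zero =>
    intro r hr hlt
    simp only [Nat.cast_zero, zero_mul] at hlt
    exact absurd (A.nonneg i r hr) hlt.not_ge
  | succ k ih =>
    intro r hr hrk v
    by_contra hv
    have hr0 := A.nonneg i r hr
    have hd0 : 0 ≤ R i - (τ i).critLen + (τ i).latest v + (τ i).cmax v := by
      linarith [hs i, (τ i).latest_nonneg v, (τ i).cmax_nonneg v]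
    have hdR : R i - (τ i).critLen + (τ i).latest v + (τ i).cmax v ≤ R i := by
      linarith [(τ i).latest_add_cmax_le_critLen v]
    set d := R i - (τ i).critLen + (τ i).latest v + (τ i).cmax v with hd
    have hQ : ∀ j r', r' ∈ (A.finite_releases j (r + d)).toFinset ↔
        r' ∈ A.releases j ∧ r' < r + d := fun j r' => Set.Finite.mem_toFinset _
    have hmain := mul_le_of_not_completed hm hσ hr (by linarith) hv
      (fun j => (A.finite_releases j (r + d)).toFinset) hQ
    rw [← Finset.Iio_insert, Finset.sum_insert Finset.notMem_Iio_self] at hmain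
    -- The window is enlarged from `d` to `R i`, the length at which `hW` makes the workload bound
    -- valid.
    have hhigh : ∑ j ∈ Finset.Iio i, ∑ r' ∈ (A.finite_releases j (r + d)).toFinset,
        σ.jobWork j r' r (r + d) ≤
        ∑ j ∈ Finset.Iio i, (τ j).carryInWorkload (R j) (R i) := by
      refine Finset.sum_le_sum fun j hj => ?_
      have hji := Finset.mem_Iio.1 hj
      refine (Finset.sum_le_sum fun r' _ =>
        jobWork_mono j r' le_rfl (show r + d ≤ r + R i by linarith)).trans
        (sum_jobWork_le_carryInWorkload hσ (hhp j hji) (hs j) (hT j) hr0 hRi (hW j hji) _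
          fun r' hr' => ?_)
      obtain ⟨h1, h2⟩ := (hQ j r').1 hr'
      exact ⟨h1, by linarith⟩
    -- Earlier jobs of task `i` are finished by `r`; later ones are released no earlier than `r +
    -- d`.
    have hown : ∑ r' ∈ (A.finite_releases i (r + d)).toFinset, σ.jobWork i r' r (r + d) ≤
        σ.jobWork i r r (r + d) := by
      rw [← Finset.sum_singleton (fun r' => σ.jobWork i r' r (r + d)) r,
        ← Finset.sum_filter_of_ne (p := fun r' => r' = r)]
      · exact Finset.sum_le_sum_of_subset_of_nonneg
          (fun r' hr' => Finset.mem_singleton.2 (Finset.mem_filter.1 hr').2)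
          fun r' _ _ => jobWork_nonneg i r' _ _
      intro r' hr' hne
      obtain ⟨h1, h2⟩ := (hQ i r').1 hr'
      by_contra hne'
      rcases lt_or_gt_of_ne hne' with hlt | hlt
      · have h3 := A.separated i r' h1 r hr hlt
        push_cast at hrk
        exact hne (jobWork_eq_zero hσ (ih r' h1 (by linarith)) (by linarith [hT i]))
      · have h3 := A.separated i r hr r' h1 hlt
        linarith [hT i]
    have hjob := jobWork_lt_of_not_completed hσ hr0 hv
    have hdesc := (τ i).critLen_le_add_sum_descendants v
    have hfix' : m * R i = ∑ j ∈ Finset.Iio i, (τ j).carryInWorkload (R j) (R i) +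
        (m - 1) * (τ i).critLen + (τ i).totalWork := by
      rw [interference, DAGTask.isol] at hfix
      calc m * R i = m * (1 / (m : ℝ) * ∑ j ∈ Finset.Iio i, (τ j).carryInWorkload (R j) (R i) +
            ((τ i).critLen + 1 / (m : ℝ) * ((τ i).totalWork - (τ i).critLen))) := by rw [← hfix]
        _ = _ := by field_simp; ring
    have hmd : m * d = m * R i - m * (τ i).critLen + m * ((τ i).latest v + (τ i).cmax v) := by
      rw [hd]; ring
    rw [add_sub_cancel_left, hmd, hfix'] at hmain
    linarith

end Schedule

/-! ### Monotone iteration and its exact fixed point -/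

section response

variable {n m : ℕ} {τ : Fin n → DAGTask} {R : Fin n → ℝ} {i : Fin n}

theorem interference_nonneg (hs : ∀ j < i, (τ j).critLen ≤ R j)
    (hT : ∀ j, R j ≤ (τ j).period) {Δ : ℝ} (hΔ : 0 ≤ Δ) : 0 ≤ interference m τ R i Δ :=
  mul_nonneg (by positivity) (Finset.sum_nonneg fun j hj =>
    DAGTask.carryInWorkload_nonneg (hs j (Finset.mem_Iio.1 hj)) (hT j) hΔ)

theorem interference_mono (hs : ∀ j < i, (τ j).critLen ≤ R j)
    (hT : ∀ j, R j ≤ (τ j).period) {x y : ℝ} (hx : 0 ≤ x) (hxy : x ≤ y) :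
    interference m τ R i x ≤ interference m τ R i y :=
  mul_le_mul_of_nonneg_left (Finset.sum_le_sum fun j hj =>
    DAGTask.carryInWorkload_mono (hs j (Finset.mem_Iio.1 hj)) (hT j) hx hxy) (by positivity)

theorem totalWork_le_of_interference_eq (hm : 0 < m) (hs : ∀ j < i, (τ j).critLen ≤ R j)
    (hT : ∀ j, R j ≤ (τ j).period) {x y : ℝ} (hx : 0 ≤ x) (hxy : x < y)
    (h : interference m τ R i x = interference m τ R i y) :
    ∀ j < i, (τ j).totalWork ≤ (τ j).carryInWorkload (R j) y := by
  have hm0 : (1 / (m : ℝ)) ≠ 0 := by positivity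
  have hsum := mul_left_cancel₀ hm0 h
  -- Equal sums of termwise ordered summands force equality of each summand.
  rw [Finset.sum_eq_sum_iff_of_le fun j hj =>
    DAGTask.carryInWorkload_mono (hs j (Finset.mem_Iio.1 hj)) (hT j) hx hxy.le] at hsum
  exact fun j hj => DAGTask.totalWork_le_carryInWorkload (hs j hj) (hT j) hx hxy
    (hsum j (Finset.mem_Iio.2 hj))

theorem isol_le_responseIter (hs : ∀ j < i, (τ j).critLen ≤ R j)
    (hT : ∀ j, R j ≤ (τ j).period) (k : ℕ) : (τ i).isol m ≤ responseIter m τ R i k := by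
  induction k with
  | zero => exact le_rfl
  | succ k ih =>
    have h0 := ((τ i).critLen_nonneg.trans (τ i).critLen_le_isol).trans ih
    exact le_add_of_nonneg_left (interference_nonneg hs hT h0)

theorem responseIter_le_succ (hs : ∀ j < i, (τ j).critLen ≤ R j)
    (hT : ∀ j, R j ≤ (τ j).period) (k : ℕ) :
    responseIter m τ R i k ≤ responseIter m τ R i (k + 1) := by
  induction k with
  | zero => exact isol_le_responseIter hs hT 1
  | succ k ih =>
    have h0 := ((τ i).critLen_nonneg.trans (τ i).critLen_le_isol).trans
      (isol_le_responseIter (m := m) hs hT k)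
    exact add_le_add_left (interference_mono hs hT h0 ih) _

theorem critLen_le_of_isComputedResponse (hR : IsComputedResponse m τ R)
    (hT : ∀ j, R j ≤ (τ j).period) (i : Fin n) : (τ i).critLen ≤ R i := by
  induction i using WellFoundedLT.induction with
  | _ i ih =>
    obtain ⟨k, -, -, hk⟩ := hR i
    rw [hk]
    exact (τ i).critLen_le_isol.trans (isol_le_responseIter ih hT _)

/-- Exact termination of the iteration forces the workload bounds of all tasks of higher priority
to cover a whole job: a strictly increasing part of the bound is never left in finitely many
steps. -/
theorem response_fixed_point (hm : 0 < m) (hR : IsComputedResponse m τ R)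
    (hD : ∀ j, R j ≤ (τ j).deadline) (i : Fin n) (hi : 0 < (τ i).totalWork) :
    R i = interference m τ R i (R i) + (τ i).isol m ∧
      ∀ j < i, (τ j).totalWork ≤ (τ j).carryInWorkload (R j) (R i) := by
  have hT : ∀ j, R j ≤ (τ j).period := fun j => (hD j).trans (τ j).deadline_le_period
  have hs : ∀ j < i, (τ j).critLen ≤ R j := fun j _ => critLen_le_of_isComputedResponse hR hT j
  have hisol : 0 < (τ i).isol m := ((τ i).critLen_pos hi).trans_le (τ i).critLen_le_isol
  obtain ⟨k, hend, hfirst, hk⟩ := hR i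
  have hDi := hD i
  rw [hk] at hDi
  have heq : responseIter m τ R i (k + 1) = responseIter m τ R i k :=
    hend.resolve_right hDi.not_gt
  have hRk : R i = responseIter m τ R i k := hk.trans heq
  have hfix : R i = interference m τ R i (R i) + (τ i).isol m := by
    conv_lhs => rw [hk, responseIter, ← hRk]
  refine ⟨hfix, ?_⟩
  cases k with
  -- There is no preceding iterate to compare with. The interference at `R i` is zero, so it agrees
  -- with that at window length `0`; this needs `R i > 0`.
  | zero =>
    have hRi : 0 < R i := by rw [hRk]; exact hisol
    refine totalWork_le_of_interference_eq hm hs hT le_rfl hRi (le_antisymm ?_ ?_)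
    · exact interference_mono hs hT le_rfl hRi.le
    · have h0 : R i = (τ i).isol m := hRk
      linarith [interference_nonneg (m := m) hs hT le_rfl]
  | succ k =>
    -- The stopping test failed one step earlier, so the last two distinct iterates are two window
    -- lengths with the same interference.
    have hlt : responseIter m τ R i k < R i := by
      rw [hRk]
      refine lt_of_le_of_ne (responseIter_le_succ hs hT k) fun h => ?_
      exact hfirst k (Nat.lt_succ_self k) (.inl h.symm)
    refine totalWork_le_of_interference_eq hm hs hT
      (hisol.le.trans (isol_le_responseIter hs hT k)) hlt ?_
    have h1 : R i = interference m τ R i (responseIter m τ R i k) + (τ i).isol m := hRk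
    linarith

end response

end

theorem mainTheorem2 (m n : ℕ) (hm : 0 < m) (τ : Fin n → DAGTask) (R : Fin n → ℝ)
    (hR : IsComputedResponse m τ R) (hD : ∀ i, R i ≤ (τ i).deadline) :
    GFPSchedulable m τ := by
  intro A σ hσ
  have hT : ∀ j, R j ≤ (τ j).period := fun j => (hD j).trans (τ j).deadline_le_period
  have hs := critLen_le_of_isComputedResponse hR hT
  have hmeets : ∀ i, σ.MeetsBound A i (R i) := fun i => by
    induction i using WellFoundedLT.induction with
    | _ i ih =>
      -- A task without work is separated because the fixed-point argument requires a positive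
      -- window length; its nodes are complete at once.
      rcases (τ i).totalWork_nonneg.eq_or_lt with hC | hC
      · exact Schedule.meetsBound_of_totalWork_eq_zero hC.symm _
      · obtain ⟨hfix, hW⟩ := response_fixed_point hm hR hD i hC
        exact Schedule.meetsBound_of_higher_priority hm hσ hs hT hfix hW ih
  rintro ⟨i, r, v⟩ hr
  exact (hmeets i r hr v).mono (by
    simp only
    linarith [(τ i).latest_add_cmax_le_critLen v, hD i])
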